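/- **Theorem 3.1 (LDLR to SDA lower bounds).** *Setting.* Let $D_\emptyset$ be a probability distribution on $\mathbb{R}^n$ and let $\mathcal{S}=\{D_u\}_{u\in S}$ be a measurable family of probability distributions on $\mathbb{R}^n$, with a prior probability measure $\mu$ on $S$. Assume that every $D_u$ has a density $\overline{D}_u = dD_u/dD_\emptyset$ with $\mathbb{E}_{x\sim D_\emptyset}\overline{D}_u(x)^2<\infty$. Write $\langle f,g\rangle=\mathbb{E}_{D_\emptyset}[fg]$ on $L^2(D_\emptyset)$, and likewise for $m$ independent samples, on $L^2(D_\emptyset^{\otimes m})$, with $\|f\|=\langle f,f\rangle^{1/2}$; for $f\in L^2(D_\emptyset)$ let $f^{\otimes m}(x_1,\dots,x_m)=f(x_1)\cdots f(x_m)$. - For $f\in L^2(D_\emptyset)$, $f^{\le d}$ is the orthogonal projection of $f$ to the span of the square-integrable polynomial functions of degree at most $d$, and $f^{>d}=f-f^{\le d}$. - For $f\in L^2(D_\emptyset^{\otimes m})$, $f^{\le d,k}$ is the orthogonal projection of $f$ to the functions of samplewise degree $(d,k)$: the span of the square-integrable polynomial functions of $(x_1,\dots,x_m)\in(\mathbb{R}^n)^m$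 that have degree at most $d$ in each $x_i$ and nonzero degree in at most $k$ of the $x_i$. - Means $\mathbb{E}_{u\sim\mu} f_u$ of $L^2$-valued functions are understood weakly: $w=\mathbb{E}_u f_u$ means that for every $g\in L^2$ the real random variable $\langle f_u,g\rangle$ is $\mu$-integrable with mean $\langle w,g\rangle$. - For $m'\in[0,\infty]$ (with $1/\infty=0$, $1/0=\infty$), the statistical dimension is $$\mathrm{SDA}(\mathcal{S},m')=\max\Big\{q\in\mathbb{N} : \mathbb{E}_{u,v\sim\mu}\big[\,|\langle \overline{D}_u,\overline{D}_v\rangle-1|\;\big|\;A\big]\le \tfrac{1}{m'}\ \text{for all events } A \text{ with } \Pr_{u,v\sim\mu}(A)\ge \tfrac1{q^2}\Big\},$$ where $u,v$ are independent, $A$ ranges over events in the joint distribution of $(u,v)$, and the value is $\infty$ if there is no maximum. *Statement.* Let $d,k,m\in\mathbb{N}$ with $k>0$ even and $m\ge k$, and let $\delta,\varepsilon\in\mathbb{R}$. Suppose that the means below exist and that 1. the $k$-sample high-degree part of the likelihood ratio satisfies $\big\|\mathbb{E}_{u\sim\mu}(\overline{D}_u^{>d})^{\otimes k}\big\|\le\delta$;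 2. the $m$-sample samplewise-$(d,k)$ low-degree likelihood ratio satisfies $\big\|\mathbb{E}_{u\sim\mu}(\overline{D}_u^{\otimes m})^{\le d,k}-1\big\|\le\varepsilon$. Then for every integer $q\ge1$, $$\mathrm{SDA}\!\left(\mathcal{S},\ \frac{m}{q^{2/k}\big(k\,\varepsilon^{2/k}+\delta^{2/k}\,m\big)}\right)\ \ge\ q,$$ where the quotient is read as $\infty$ if its denominator is $0$. -/

import Mathlib

open MeasureTheory ProbabilityTheory
open scoped ENNReal

noncomputable section

/-! ### Polynomials of bounded (samplewise) degree as subspaces of `L²` -/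

/-- Evaluation of a real polynomial in the coordinates of `m` samples `x₁, …, xₘ ∈ ℝⁿ`. -/
def evalSamples {m n : ℕ} (p : MvPolynomial (Fin m × Fin n) ℝ) (x : Fin m → Fin n → ℝ) : ℝ :=
  MvPolynomial.eval (fun ij => x ij.1 ij.2) p

/-- The degree of `p(x₁, …, xₘ)` in the (vector) variable `xᵢ ∈ ℝⁿ`: the largest total degree
in the coordinates of `xᵢ` of a monomial occurring in `p`. -/
def degreeInSample {m n : ℕ} (p : MvPolynomial (Fin m × Fin n) ℝ) (i : Fin m) : ℕ :=
  p.support.sup fun s => ∑ j, s (i, j)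

/-- The span in `L²(ν)` of the square-integrable functions of degree at most `d`. -/
def lowDegree {n : ℕ} (ν : Measure (Fin n → ℝ)) (d : ℕ) : Submodule ℝ (Lp ℝ 2 ν) :=
  Submodule.span ℝ {f | ∃ p : MvPolynomial (Fin n) ℝ, p.totalDegree ≤ d ∧
    f =ᵐ[ν] fun x => MvPolynomial.eval x p}

/-- The space of functions of samplewise degree `(d, k)` in `L²(ρ)`, `ρ` a measure on `m`-tuples
of samples: linear combinations of square-integrable functions that have degree at most `d` in
each `xᵢ` and nonzero degree in at most `k` of the `xᵢ`. -/
def lowSamplewiseDegree {m n : ℕ} (ρ : Measure (Fin m → Fin n → ℝ)) (d k : ℕ) :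
    Submodule ℝ (Lp ℝ 2 ρ) :=
  Submodule.span ℝ {f | ∃ p : MvPolynomial (Fin m × Fin n) ℝ,
    (∀ i, degreeInSample p i ≤ d) ∧
    (Finset.univ.filter fun i => degreeInSample p i ≠ 0).card ≤ k ∧
    f =ᵐ[ρ] evalSamples p}

/-- Classes of polynomials of bounded total degree span a finite-dimensional space. -/
theorem finiteDimensional_span_of_polynomial {α σ : Type*} [MeasurableSpace α] [Finite σ]
    (ρ : Measure α) (c : α → σ → ℝ) (hc : Measurable c) (N : ℕ) (T : Set (Lp ℝ 2 ρ))
    (hT : ∀ f ∈ T, ∃ p : MvPolynomial σ ℝ, p.totalDegree ≤ N ∧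
      f =ᵐ[ρ] fun x => MvPolynomial.eval (c x) p) :
    FiniteDimensional ℝ (Submodule.span ℝ T) := by
  have hm : ∀ p : MvPolynomial σ ℝ,
      AEStronglyMeasurable (fun x => MvPolynomial.eval (c x) p) ρ := fun p =>
    ((MvPolynomial.continuous_eval p).measurable.comp hc).aestronglyMeasurable
  let E : MvPolynomial σ ℝ →ₗ[ℝ] (α →ₘ[ρ] ℝ) :=
    { toFun := fun p => AEEqFun.mk _ (hm p)
      map_add' := fun p q => by
        refine Eq.trans ?_ (AEEqFun.mk_add_mk _ _ (hm p) (hm q))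
        exact AEEqFun.mk_eq_mk.2 (Filter.Eventually.of_forall fun x => by simp)
      map_smul' := fun a p => by
        refine Eq.trans ?_ (AEEqFun.smul_mk a _ (hm p))
        exact AEEqFun.mk_eq_mk.2 (Filter.Eventually.of_forall fun x => by
          simp [MvPolynomial.smul_eval]) }
  let W := (MvPolynomial.restrictTotalDegree σ ℝ N).map E
  have hfin : FiniteDimensional ℝ (MvPolynomial.restrictTotalDegree σ ℝ N) := by
    have hs : {s : σ →₀ ℕ | s.degree ≤ N}.Finite := Finsupp.finite_of_degree_le N
    have : Finite {s : σ →₀ ℕ // s ∈ {s : σ →₀ ℕ | s.degree ≤ N}} := hs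
    exact Module.Finite.of_basis
      (MvPolynomial.basisRestrictSupport ℝ {s : σ →₀ ℕ | s.degree ≤ N})
  let ι : Lp ℝ 2 ρ →ₗ[ℝ] (α →ₘ[ρ] ℝ) :=
    { toFun := fun f => (f : α →ₘ[ρ] ℝ), map_add' := fun _ _ => rfl, map_smul' := fun _ _ => rfl }
  have hle : Submodule.span ℝ T ≤ W.comap ι := by
    refine Submodule.span_le.2 fun f hf => ?_
    obtain ⟨p, hp, hfp⟩ := hT f hf
    refine ⟨p, (MvPolynomial.mem_restrictTotalDegree σ N p).2 hp, ?_⟩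
    exact (AEEqFun.ext ((AEEqFun.coeFn_mk _ (hm p)).trans hfp.symm) :
      AEEqFun.mk _ (hm p) = (f : α →ₘ[ρ] ℝ))
  let r : Submodule.span ℝ T →ₗ[ℝ] W :=
    (ι.comp (Submodule.span ℝ T).subtype).codRestrict W fun f => hle f.2
  refine FiniteDimensional.of_injective r fun f g h => ?_
  have h' : ((f : Lp ℝ 2 ρ) : α →ₘ[ρ] ℝ) = ((g : Lp ℝ 2 ρ) : α →ₘ[ρ] ℝ) :=
    congrArg (fun w : W => (w : α →ₘ[ρ] ℝ)) h
  exact Subtype.ext (Subtype.ext h')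

instance finiteDimensional_lowDegree {n : ℕ} (ν : Measure (Fin n → ℝ)) (d : ℕ) :
    FiniteDimensional ℝ (lowDegree ν d) :=
  finiteDimensional_span_of_polynomial ν id measurable_id d _ fun _ h => h

instance finiteDimensional_lowSamplewiseDegree {m n : ℕ} (ρ : Measure (Fin m → Fin n → ℝ)) (d k : ℕ) :
    FiniteDimensional ℝ (lowSamplewiseDegree ρ d k) := by
  refine finiteDimensional_span_of_polynomial ρ (fun x (ij : Fin m × Fin n) => x ij.1 ij.2)
    (by fun_prop) (m * d) _ ?_
  rintro f ⟨p, hp, -, hf⟩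
  refine ⟨p, Finset.sup_le fun s hs => ?_, hf⟩
  rw [Finsupp.sum_fintype _ _ fun _ => rfl, Fintype.sum_prod_type]
  calc ∑ i, ∑ j, s (i, j) ≤ ∑ _i : Fin m, d := Finset.sum_le_sum fun i _ =>
        (Finset.le_sup (f := fun s : Fin m × Fin n →₀ ℕ => ∑ j, s (i, j)) hs).trans (hp i)
    _ = m * d := by simp

/-- `f^{≤ d}`: the orthogonal projection of `f` to the functions of degree at most `d`. -/
def lowPart {n : ℕ} {ν : Measure (Fin n → ℝ)} (d : ℕ) (f : Lp ℝ 2 ν) : Lp ℝ 2 ν :=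
  (lowDegree ν d).starProjection f

/-- `f^{> d} = f - f^{≤ d}`: the part of `f` orthogonal to the functions of degree at most `d`. -/
def highPart {n : ℕ} {ν : Measure (Fin n → ℝ)} (d : ℕ) (f : Lp ℝ 2 ν) : Lp ℝ 2 ν :=
  f - lowPart d f

/-- `f^{≤ d,k}`: the orthogonal projection of `f` to the functions of samplewise degree `(d, k)`. -/
def lowSamplewisePart {m n : ℕ} {ρ : Measure (Fin m → Fin n → ℝ)} (d k : ℕ) (f : Lp ℝ 2 ρ) :
    Lp ℝ 2 ρ :=
  (lowSamplewiseDegree ρ d k).starProjection f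

/-! ### Tensor powers and means -/

/-- The joint distribution `ν^{⊗ m}` of `m` independent samples from `ν`. -/
abbrev samples {n : ℕ} (ν : Measure (Fin n → ℝ)) (m : ℕ) : Measure (Fin m → Fin n → ℝ) :=
  Measure.pi fun _ => ν

theorem memLp_tensorPower {n : ℕ} {ν : Measure (Fin n → ℝ)} [IsProbabilityMeasure ν] (m : ℕ)
    (f : Lp ℝ 2 ν) : MemLp (fun x : Fin m → Fin n → ℝ => ∏ i, f (x i)) 2 (samples ν m) := by
  have h1 : AEStronglyMeasurable (fun x : Fin m → Fin n → ℝ => ∏ i, f (x i)) (samples ν m) :=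
    ((Finset.univ.stronglyMeasurable_fun_prod fun i _ =>
      (Lp.stronglyMeasurable f).comp_measurable (measurable_pi_apply i))).aestronglyMeasurable
  rw [memLp_two_iff_integrable_sq h1]
  simp_rw [← Finset.prod_pow]
  exact Integrable.fintype_prod (f := fun _ : Fin m => fun y : Fin n → ℝ => f y ^ 2)
    fun _ => (Lp.memLp f).integrable_sq

/-- `f^{⊗ m}(x₁, …, xₘ) = f(x₁) ⋯ f(xₘ)`, as an element of `L²(ν^{⊗ m})`. -/
def tensorPower {n : ℕ} {ν : Measure (Fin n → ℝ)} [IsProbabilityMeasure ν] (m : ℕ)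
    (f : Lp ℝ 2 ν) : Lp ℝ 2 (samples ν m) :=
  (memLp_tensorPower m f).toLp

/-- `w = E_{u ∼ μ} f_u` for a random vector `f_u` of a real Hilbert space, in the weak (Pettis)
sense: for every `g`, the real random variable `⟨f_u, g⟩` is integrable with mean `⟨w, g⟩`.
Such a `w` is unique, and it is the Bochner integral of `f` whenever `f` is Bochner integrable. -/
def IsMean {S H : Type*} [MeasurableSpace S] [NormedAddCommGroup H] [InnerProductSpace ℝ H]
    (μ : Measure S) (f : S → H) (w : H) : Prop :=
  ∀ g : H, Integrable (fun u => inner ℝ (f u) g) μ ∧ ∫ u, inner ℝ (f u) g ∂μ = inner ℝ w g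

/-! ### Testing problems and statistical dimension -/

/-- A simple-versus-simple testing problem on `ℝⁿ`: a null distribution, a (measurable) family of
alternative distributions `D_u`, `u ∈ S`, and a prior on `S`, such that every `D_u` has a density
relative to the null distribution and this density is square integrable under the null. -/
structure TestingProblem (n : ℕ) (S : Type*) [MeasurableSpace S] where
  null : Measure (Fin n → ℝ)
  alt : Kernel S (Fin n → ℝ)
  prior : Measure S
  isProbabilityMeasure_null : IsProbabilityMeasure null
  isMarkovKernel_alt : IsMarkovKernel alt
  isProbabilityMeasure_prior : IsProbabilityMeasure prior
  absolutelyContinuous : ∀ u, alt u ≪ null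
  memLp_rnDeriv : ∀ u, MemLp (fun x => ((alt u).rnDeriv null x).toReal) 2 null

namespace TestingProblem

variable {n : ℕ} {S : Type*} [MeasurableSpace S] (P : TestingProblem n S)

instance instNull : IsProbabilityMeasure P.null := P.isProbabilityMeasure_null

instance instAlt : IsMarkovKernel P.alt := P.isMarkovKernel_alt

instance instPrior : IsProbabilityMeasure P.prior := P.isProbabilityMeasure_prior

/-- The relative density (likelihood ratio) of `D_u` with respect to the null distribution, as an
element of `L²` of the null distribution. -/
def relDensity (u : S) : Lp ℝ 2 P.null :=
  (P.memLp_rnDeriv u).toLp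

/-- `q` is admissible in the definition of the statistical dimension at sample size `m`: the
conditional expectation of `|⟨D̄_u, D̄_v⟩ - 1|` is at most `1 / m` given any event of probability
at least `1 / q²` over independent `u, v` drawn from the prior. -/
def SDABound (m : ℝ≥0∞) (q : ℕ) : Prop :=
  ∀ A : Set (S × S), MeasurableSet A → 1 / (q : ℝ≥0∞) ^ 2 ≤ (P.prior.prod P.prior) A →
    ∫⁻ w, ENNReal.ofReal |inner ℝ (P.relDensity w.1) (P.relDensity w.2) - 1|
      ∂(cond (P.prior.prod P.prior) A) ≤ 1 / m

/-- The statistical dimension `SDA(m)`: the largest admissible `q ∈ ℕ` (and `⊤` if every `q` is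
admissible). The sample parameter `m` lies in `[0, ∞]`, with `1 / ∞ = 0`. -/
def SDA (m : ℝ≥0∞) : ℕ∞ :=
  ⨆ q : {q : ℕ // P.SDABound m q}, ((q : ℕ) : ℕ∞)

end TestingProblem

end

/-!
Write `D̄_u = D̄_u^{≤ d} + D̄_u^{> d}`, so that `⟨D̄_u, D̄_v⟩ - 1 = L(u, v) + H(u, v)` with
`L(u, v) = ⟨D̄_u^{≤ d}, D̄_v^{≤ d}⟩ - 1` and `H(u, v) = ⟨D̄_u^{> d}, D̄_v^{> d}⟩`. The hypotheses
bound the moments of order `k` of the two parts over independent `u, v`.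

* High degrees: `H(u, v)^k = ⟨(D̄_u^{> d})^{⊗ k}, (D̄_v^{> d})^{⊗ k}⟩`, so `E H^k` is the squared norm
  of the mean of `(D̄_u^{> d})^{⊗ k}`, and is at most `δ²` (`TestingProblem.lintegral_highPart_pow`).
* Low degrees: let `1, e₁, e₂, …` be an orthonormal basis of the functions of degree at most `d`.
  The tensors `∏_{i ∈ T} e_{α i}(xᵢ)`, for `T` a set of `k` samples and `α` a labelling of `T`, are
  orthonormal, orthogonal to `1`, and of samplewise degree `(d, k)`. As
  `L(u, v) = ∑ⱼ ⟨D̄_u, eⱼ⟩⟨D̄_v, eⱼ⟩`, the squared coefficients of the low-degree likelihood ratio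
  along the tensors for one `T` add up to `E L^k`, and Bessel's inequality gives
  `(m choose k) E L^k ≤ ε²` (`TestingProblem.choose_mul_integral_lowPart_pow_le`). With
  `(m / k)^k ≤ (m choose k)` this is `E L^k ≤ (k / m)^k ε²`.

As `k` is even, these are moments of `|L|` and `|H|`. Conditioning on an event of probability at
least `1 / q²` multiplies them by at most `q²`, and Jensen's inequality (`lintegral_cond_le`) bounds
the conditional mean of `|L| + |H|` by `q^{2/k} (k ε^{2/k} / m + δ^{2/k})`, which is `1 / m'` for
the sample parameter `m'` of the theorem.
-/

noncomputable section

/-! ### Pure tensors in `L²(ν^{⊗ m})` -/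

section TensorProduct

variable {n m : ℕ} {ν : Measure (Fin n → ℝ)} [IsProbabilityMeasure ν]

theorem memLp_tensorProduct (f : Fin m → Lp ℝ 2 ν) :
    MemLp (fun x : Fin m → Fin n → ℝ => ∏ i, f i (x i)) 2 (samples ν m) := by
  have h1 : AEStronglyMeasurable (fun x : Fin m → Fin n → ℝ => ∏ i, f i (x i)) (samples ν m) :=
    (Finset.univ.stronglyMeasurable_fun_prod fun i _ =>
      (Lp.stronglyMeasurable (f i)).comp_measurable (measurable_pi_apply i)).aestronglyMeasurable
  rw [memLp_two_iff_integrable_sq h1]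
  simp_rw [← Finset.prod_pow]
  exact Integrable.fintype_prod (f := fun i => fun y : Fin n → ℝ => f i y ^ 2)
    fun i => (Lp.memLp (f i)).integrable_sq

/-- The pure tensor `f₁(x₁) ⋯ fₘ(xₘ)`, as an element of `L²(ν^{⊗ m})`. -/
def tensorProduct (f : Fin m → Lp ℝ 2 ν) : Lp ℝ 2 (samples ν m) :=
  (memLp_tensorProduct f).toLp

theorem coeFn_tensorProduct (f : Fin m → Lp ℝ 2 ν) :
    tensorProduct f =ᵐ[samples ν m] fun x => ∏ i, f i (x i) :=
  (memLp_tensorProduct f).coeFn_toLp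

theorem tensorPower_eq_tensorProduct (f : Lp ℝ 2 ν) :
    tensorPower m f = tensorProduct fun _ => f :=
  rfl

theorem inner_tensorProduct (f g : Fin m → Lp ℝ 2 ν) :
    inner ℝ (tensorProduct f) (tensorProduct g) = ∏ i, inner ℝ (f i) (g i) := by
  simp_rw [L2.inner_def]
  rw [← integral_fintype_prod_eq_prod (μ := fun _ : Fin m => ν)
    (fun i x => inner ℝ (f i x) (g i x))]
  refine integral_congr_ae ?_
  filter_upwards [coeFn_tensorProduct f, coeFn_tensorProduct g] with x hf hg
  simp [hf, hg, Finset.prod_mul_distrib]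

theorem inner_tensorPower (f g : Lp ℝ 2 ν) :
    inner ℝ (tensorPower m f) (tensorPower m g) = inner ℝ f g ^ m := by
  simp [tensorPower_eq_tensorProduct, inner_tensorProduct]

theorem orthonormal_tensorProduct {I : Type*} {e : I → Lp ℝ 2 ν} (he : Orthonormal ℝ e) :
    Orthonormal ℝ fun β : Fin m → I => tensorProduct fun i => e (β i) := by
  classical
  rw [orthonormal_iff_ite] at he ⊢
  intro β γ
  simp only [inner_tensorProduct, he]
  rw [Finset.prod_ite_zero]
  simp [funext_iff]

theorem tensorProduct_const_one :
    tensorProduct (fun _ : Fin m => Lp.const 2 ν (1 : ℝ)) = Lp.const 2 (samples ν m) 1 := by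
  refine Lp.ext ?_
  filter_upwards [coeFn_tensorProduct (fun _ : Fin m => Lp.const 2 ν (1 : ℝ))] with x hx
  simp [hx]

end TensorProduct

/-! ### Degrees in a single sample -/

section Degree

variable {m n : ℕ}

theorem degreeInSample_one (i : Fin m) :
    degreeInSample (1 : MvPolynomial (Fin m × Fin n) ℝ) i = 0 := by
  classical
  refine Nat.le_zero.1 (Finset.sup_le fun s hs => ?_)
  have : s = 0 := by
    by_contra h
    exact MvPolynomial.mem_support_iff.1 hs (by simp [MvPolynomial.coeff_one, Ne.symm h])
  simp [this]

theorem degreeInSample_mul_le (p q : MvPolynomial (Fin m × Fin n) ℝ) (i : Fin m) :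
    degreeInSample (p * q) i ≤ degreeInSample p i + degreeInSample q i := by
  classical
  refine Finset.sup_le fun s hs => ?_
  obtain ⟨a, ha, b, hb, rfl⟩ := Finset.mem_add.1 (MvPolynomial.support_mul p q hs)
  simp only [Finsupp.add_apply, Finset.sum_add_distrib]
  exact add_le_add
    (Finset.le_sup (f := fun s : Fin m × Fin n →₀ ℕ => ∑ j, s (i, j)) ha)
    (Finset.le_sup (f := fun s : Fin m × Fin n →₀ ℕ => ∑ j, s (i, j)) hb)

theorem degreeInSample_prod_le {ι : Type*} (T : Finset ι)
    (p : ι → MvPolynomial (Fin m × Fin n) ℝ) (i : Fin m) :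
    degreeInSample (∏ t ∈ T, p t) i ≤ ∑ t ∈ T, degreeInSample (p t) i := by
  classical
  induction T using Finset.induction_on with
  | empty => simp [degreeInSample_one]
  | insert t T ht ih =>
    rw [Finset.prod_insert ht, Finset.sum_insert ht]
    exact (degreeInSample_mul_le _ _ i).trans (by gcongr)

theorem degreeInSample_rename_le (i i' : Fin m) (p : MvPolynomial (Fin n) ℝ) :
    degreeInSample (MvPolynomial.rename (Prod.mk i') p) i ≤
      if i' = i then p.totalDegree else 0 := by
  classical
  refine Finset.sup_le fun s hs => ?_
  have hinj : Function.Injective (Prod.mk i' : Fin n → Fin m × Fin n) := Prod.mk_right_injective i'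
  rw [MvPolynomial.support_rename_of_injective hinj] at hs
  obtain ⟨t, ht, rfl⟩ := Finset.mem_image.1 hs
  split_ifs with h
  · subst h
    simp only [Finsupp.mapDomain_apply hinj]
    have := MvPolynomial.le_totalDegree ht
    rwa [Finsupp.sum_fintype _ _ fun _ => rfl] at this
  · refine (Finset.sum_eq_zero fun j _ => Finsupp.mapDomain_of_notMem_range _ _ ?_).le
    rintro ⟨a, ha⟩
    exact h (congrArg Prod.fst ha)

end Degree

/-! ### Functions of low degree and low samplewise degree -/

section LowDegree

variable {n m : ℕ} {ν : Measure (Fin n → ℝ)}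

theorem exists_polynomial_of_mem_lowDegree {d : ℕ} {f : Lp ℝ 2 ν} (hf : f ∈ lowDegree ν d) :
    ∃ p : MvPolynomial (Fin n) ℝ, p.totalDegree ≤ d ∧
      f =ᵐ[ν] fun x => MvPolynomial.eval x p := by
  induction hf using Submodule.span_induction with
  | mem f hf => exact hf
  | zero => exact ⟨0, by simp, by
      filter_upwards [Lp.coeFn_zero ℝ 2 ν] with x hx
      rw [hx, map_zero, Pi.zero_apply]⟩
  | add f g _ _ hf hg =>
    obtain ⟨p, hp, hfp⟩ := hf
    obtain ⟨r, hr, hgr⟩ := hg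
    refine ⟨p + r, (MvPolynomial.totalDegree_add p r).trans (max_le hp hr), ?_⟩
    filter_upwards [Lp.coeFn_add f g, hfp, hgr] with x h1 h2 h3
    rw [h1, Pi.add_apply, h2, h3, map_add]
  | smul c f _ hf =>
    obtain ⟨p, hp, hfp⟩ := hf
    refine ⟨c • p, (MvPolynomial.totalDegree_smul_le c p).trans hp, ?_⟩
    filter_upwards [Lp.coeFn_smul c f, hfp] with x h1 h2
    rw [h1, Pi.smul_apply, h2, MvPolynomial.smul_eval, smul_eq_mul]

theorem inner_highPart (d : ℕ) (f g : Lp ℝ 2 ν) :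
    inner ℝ (highPart d f) (highPart d g) =
      inner ℝ f g - inner ℝ (lowPart d f) (lowPart d g) := by
  have h1 : inner ℝ (lowPart d f) (lowPart d g) = inner ℝ f (lowPart d g) := by
    have := Submodule.starProjection_inner_eq_zero (K := lowDegree ν d) f (lowPart d g)
      (Submodule.starProjection_apply_mem _ _)
    rw [inner_sub_left] at this
    exact (sub_eq_zero.1 this).symm
  have h2 : inner ℝ (lowPart d f) g = inner ℝ f (lowPart d g) :=
    Submodule.inner_starProjection_left_eq_right _ f g
  simp only [highPart, inner_sub_left, inner_sub_right, h1, h2]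
  ring

variable [IsProbabilityMeasure ν]

theorem const_one_mem_lowDegree (d : ℕ) : Lp.const 2 ν (1 : ℝ) ∈ lowDegree ν d := by
  refine Submodule.subset_span ⟨1, by simp, ?_⟩
  filter_upwards with x
  simp

/-- A pure tensor of functions of degree at most `d`, all but at most `k` of which are `1`, has
samplewise degree `(d, k)`. -/
theorem tensorProduct_mem_lowSamplewiseDegree {d k : ℕ} {f : Fin m → Lp ℝ 2 ν}
    (T : Finset (Fin m)) (hT : T.card ≤ k) (hf : ∀ i, f i ∈ lowDegree ν d)
    (hf1 : ∀ i, i ∉ T → f i = Lp.const 2 ν 1) :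
    tensorProduct f ∈ lowSamplewiseDegree (samples ν m) d k := by
  classical
  choose p hp hfp using fun i => exists_polynomial_of_mem_lowDegree (hf i)
  have hdeg : ∀ i, degreeInSample (∏ t ∈ T, MvPolynomial.rename (Prod.mk t) (p t)) i ≤
      if i ∈ T then (p i).totalDegree else 0 := fun i => by
    refine (degreeInSample_prod_le T _ i).trans ?_
    refine (Finset.sum_le_sum fun t _ => degreeInSample_rename_le i t (p t)).trans ?_
    rw [Finset.sum_ite_eq' T i]
  refine Submodule.subset_span ⟨∏ t ∈ T, MvPolynomial.rename (Prod.mk t) (p t), fun i => ?_, ?_, ?_⟩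
  · refine (hdeg i).trans ?_
    split_ifs
    exacts [hp i, Nat.zero_le d]
  · refine (Finset.card_le_card fun i hi => ?_).trans hT
    by_contra hiT
    exact (Finset.mem_filter.1 hi).2 (by simpa [hiT] using hdeg i)
  · have h1 : ∀ᵐ x ∂samples ν m, ∀ i, f i (x i) = MvPolynomial.eval (x i) (p i) :=
      ae_all_iff.2 fun i =>
        (Measure.quasiMeasurePreserving_eval (fun _ : Fin m => ν) i).ae (hfp i)
    filter_upwards [coeFn_tensorProduct f, h1] with x hx h1
    rw [hx, evalSamples, map_prod, ← Finset.prod_subset (Finset.subset_univ T)]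
    · exact Finset.prod_congr rfl fun i _ => by rw [h1, MvPolynomial.eval_rename]; rfl
    · intro i _ hi
      simp [hf1 i hi]

/-- `L²(ν)` functions of degree at most `d` have an orthonormal basis that contains `1`. -/
theorem exists_orthonormalBasis_lowDegree (ν : Measure (Fin n → ℝ)) [IsProbabilityMeasure ν]
    (d : ℕ) : ∃ (u : Finset (lowDegree ν d)) (b : OrthonormalBasis u ℝ (lowDegree ν d)) (o : u),
      ((b o : lowDegree ν d) : Lp ℝ 2 ν) = Lp.const 2 ν 1 := by
  let one : lowDegree ν d := ⟨Lp.const 2 ν 1, const_one_mem_lowDegree d⟩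
  have hone : ‖one‖ = 1 := by
    change ‖Lp.const 2 ν (1 : ℝ)‖ = 1
    rw [Lp.norm_const] <;> simp
  have hv : Orthonormal ℝ ((↑) : ({one} : Set (lowDegree ν d)) → lowDegree ν d) := by
    refine ⟨fun i => ?_, fun i j hij => (hij (Subsingleton.elim i j)).elim⟩
    rw [Set.mem_singleton_iff.1 i.2, hone]
  obtain ⟨u, b, hvu, hb⟩ := hv.exists_orthonormalBasis_extension
  refine ⟨u, b, ⟨one, hvu rfl⟩, ?_⟩
  rw [hb]

/-- Parseval's identity for the projection to a finite-dimensional subspace. -/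
theorem inner_starProjection_eq_sum {H I : Type*} [NormedAddCommGroup H] [InnerProductSpace ℝ H]
    [Fintype I] (K : Submodule ℝ H) [K.HasOrthogonalProjection] (b : OrthonormalBasis I ℝ K)
    (f g : H) :
    inner ℝ (K.starProjection f) (K.starProjection g) =
      ∑ i, inner ℝ f (b i : H) * inner ℝ g (b i : H) := by
  have h : ∀ (x : H) i, inner ℝ x (b i : H) = inner ℝ (K.orthogonalProjectionOnto x) (b i) := by
    intro x i
    rw [real_inner_comm, ← Submodule.inner_orthogonalProjectionOnto_eq_of_mem_left, real_inner_comm]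
  simp_rw [h]
  rw [Submodule.starProjection_apply, Submodule.starProjection_apply, ← Submodule.coe_inner,
    ← b.sum_inner_mul_inner]
  exact Finset.sum_congr rfl fun i _ => by rw [real_inner_comm (b i) (K.orthogonalProjectionOnto g)]

end LowDegree

/-! ### Measurability and normalization of the relative densities -/

namespace TestingProblem

variable {n : ℕ} {S : Type*} [MeasurableSpace S] (P : TestingProblem n S)

/-- A version of the relative densities that is jointly measurable in the parameter and the
sample. -/
theorem exists_measurable_relDensity :
    ∃ r : S → (Fin n → ℝ) → ℝ, Measurable (Function.uncurry r) ∧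
      ∀ u, P.relDensity u =ᵐ[P.null] r u := by
  refine ⟨fun u x => (P.alt.rnDeriv (Kernel.const S P.null) u x).toReal,
    (Kernel.measurable_rnDeriv P.alt (Kernel.const S P.null)).ennreal_toReal, fun u => ?_⟩
  have h := Kernel.rnDeriv_eq_rnDeriv_measure (κ := P.alt) (η := Kernel.const S P.null) (a := u)
  rw [Kernel.const_apply] at h
  filter_upwards [(P.memLp_rnDeriv u).coeFn_toLp, h] with x h1 h2
  rw [relDensity, h1, h2]

theorem measurable_inner_relDensity_left (g : Lp ℝ 2 P.null) :
    Measurable fun u => inner ℝ (P.relDensity u) g := by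
  obtain ⟨r, hr, hrD⟩ := P.exists_measurable_relDensity
  have h : ∀ u, inner ℝ (P.relDensity u) g = ∫ x, r u x * g x ∂P.null := fun u => by
    rw [L2.inner_def]
    refine integral_congr_ae ?_
    filter_upwards [hrD u] with x hx
    simp [hx, mul_comm]
  simp_rw [h]
  have hm : StronglyMeasurable (Function.uncurry fun (u : S) (x : Fin n → ℝ) => r u x * g x) :=
    (hr.mul ((Lp.stronglyMeasurable g).measurable.comp measurable_snd)).stronglyMeasurable
  exact hm.integral_prod_right.measurable

theorem measurable_inner_relDensity :
    Measurable fun w : S × S => inner ℝ (P.relDensity w.1) (P.relDensity w.2) := by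
  obtain ⟨r, hr, hrD⟩ := P.exists_measurable_relDensity
  have h : ∀ w : S × S, inner ℝ (P.relDensity w.1) (P.relDensity w.2) =
      ∫ x, r w.1 x * r w.2 x ∂P.null := fun w => by
    rw [L2.inner_def]
    refine integral_congr_ae ?_
    filter_upwards [hrD w.1, hrD w.2] with x h1 h2
    simp [h1, h2, mul_comm]
  simp_rw [h]
  have hm : StronglyMeasurable
      (Function.uncurry fun (w : S × S) (x : Fin n → ℝ) => r w.1 x * r w.2 x) :=
    ((hr.comp ((measurable_fst.comp measurable_fst).prodMk measurable_snd)).mul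
      (hr.comp ((measurable_snd.comp measurable_fst).prodMk measurable_snd))).stronglyMeasurable
  exact hm.integral_prod_right.measurable

theorem inner_relDensity_const_one (u : S) :
    inner ℝ (P.relDensity u) (Lp.const 2 P.null 1) = 1 := by
  refine Eq.trans ?_
    ((Measure.integral_toReal_rnDeriv (P.absolutelyContinuous u)).trans probReal_univ)
  rw [L2.inner_def]
  refine integral_congr_ae ?_
  filter_upwards [(P.memLp_rnDeriv u).coeFn_toLp] with x hx
  simp [relDensity, hx]

end TestingProblem

/-! ### Moments of the low- and high-degree correlations -/

/-- If `u, v` are independent, the moment `E (∑ⱼ aⱼ(u) aⱼ(v))^r` is a sum of squares: the squared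
norm of the mean of the `r`-th tensor power of the vector `a(u)`. The index type `ι`, with `r`
elements, labels the tensor factors. -/
theorem integral_sum_mul_pow_card {S J ι : Type*} [MeasurableSpace S] [Fintype J] [Fintype ι]
    [DecidableEq ι] (μ : Measure S) [SFinite μ] (a : S → J → ℝ)
    (ha : ∀ α : ι → J, Integrable (fun u => ∏ i, a u (α i)) μ) :
    Integrable (fun w : S × S => (∑ j, a w.1 j * a w.2 j) ^ Fintype.card ι) (μ.prod μ) ∧
      ∫ w, (∑ j, a w.1 j * a w.2 j) ^ Fintype.card ι ∂μ.prod μ =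
        ∑ α : ι → J, (∫ u, ∏ i, a u (α i) ∂μ) ^ 2 := by
  have h : ∀ w : S × S, (∑ j, a w.1 j * a w.2 j) ^ Fintype.card ι =
      ∑ α : ι → J, (∏ i, a w.1 (α i)) * ∏ i, a w.2 (α i) := fun w => by
    rw [← Finset.card_univ, ← Finset.prod_const, Finset.prod_univ_sum, Fintype.piFinset_univ]
    simp_rw [Finset.prod_mul_distrib]
  have hi : ∀ α : ι → J,
      Integrable (fun w : S × S => (∏ i, a w.1 (α i)) * ∏ i, a w.2 (α i)) (μ.prod μ) :=
    fun α => (ha α).mul_prod (ha α)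
  simp_rw [h]
  refine ⟨integrable_finsetSum _ fun α _ => hi α, ?_⟩
  rw [integral_finsetSum _ fun α _ => hi α]
  refine Finset.sum_congr rfl fun α _ => ?_
  rw [integral_prod_mul (μ := μ) (ν := μ) (fun u => ∏ i, a u (α i)) fun u => ∏ i, a u (α i), sq]

namespace TestingProblem

variable {n : ℕ} {S : Type*} [MeasurableSpace S] (P : TestingProblem n S)

/-- The low-degree correlation `⟨D̄_u^{≤ d}, D̄_v^{≤ d}⟩ - 1` is `∑ⱼ ⟨D̄_u, eⱼ⟩⟨D̄_v, eⱼ⟩` for an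
orthonormal basis `1, e₁, e₂, …` of the functions of degree at most `d`. -/
theorem inner_lowPart_relDensity_sub_one {d : ℕ} {I : Type*} [Fintype I] [DecidableEq I]
    (b : OrthonormalBasis I ℝ (lowDegree P.null d)) (o : I)
    (ho : (b o : Lp ℝ 2 P.null) = Lp.const 2 P.null 1) (u v : S) :
    inner ℝ (lowPart d (P.relDensity u)) (lowPart d (P.relDensity v)) - 1 =
      ∑ j : {i // i ≠ o}, inner ℝ (P.relDensity u) (b j : Lp ℝ 2 P.null) *
        inner ℝ (P.relDensity v) (b j : Lp ℝ 2 P.null) := by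
  rw [lowPart, lowPart, inner_starProjection_eq_sum _ b, Fintype.sum_eq_add_sum_subtype_ne _ o,
    ho, inner_relDensity_const_one, inner_relDensity_const_one]
  ring

theorem measurable_inner_lowPart_relDensity (d : ℕ) :
    Measurable fun w : S × S =>
      inner ℝ (lowPart d (P.relDensity w.1)) (lowPart d (P.relDensity w.2)) := by
  simp_rw [lowPart, inner_starProjection_eq_sum _ (stdOrthonormalBasis ℝ (lowDegree P.null d))]
  exact Finset.measurable_fun_sum _ fun i _ =>
    ((P.measurable_inner_relDensity_left _).comp measurable_fst).mul
      ((P.measurable_inner_relDensity_left _).comp measurable_snd)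

/-- The moment of order `k` of the low-degree correlation is controlled by the low-degree
likelihood ratio: by Bessel's inequality for the tensors `∏ᵢ e_{α i}(xᵢ)`, `i ∈ T`, with `T` a set
of `k` samples and `1, e₁, e₂, …` an orthonormal basis of the functions of degree at most `d`. -/
theorem choose_mul_integral_lowPart_pow_le {d k m : ℕ} {G : Lp ℝ 2 (samples P.null m)}
    (hk0 : 0 < k) (hkm : k ≤ m)
    (hG : IsMean P.prior (fun u => lowSamplewisePart d k (tensorPower m (P.relDensity u))) G) :
    Integrable (fun w : S × S =>
        (inner ℝ (lowPart d (P.relDensity w.1)) (lowPart d (P.relDensity w.2)) - 1) ^ k)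
        (P.prior.prod P.prior) ∧
      (m.choose k : ℝ) * ∫ w, (inner ℝ (lowPart d (P.relDensity w.1))
        (lowPart d (P.relDensity w.2)) - 1) ^ k ∂P.prior.prod P.prior ≤
          ‖G - Lp.const 2 (samples P.null m) 1‖ ^ 2 := by
  classical
  obtain ⟨I, b, o, ho⟩ := exists_orthonormalBasis_lowDegree P.null d
  let J := {i : I // i ≠ o}
  let e : I → Lp ℝ 2 P.null := fun i => (b i : Lp ℝ 2 P.null)
  have he : Orthonormal ℝ e := b.orthonormal.comp_linearIsometry (lowDegree P.null d).subtypeₗᵢ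
  let a : S → J → ℝ := fun u j => inner ℝ (P.relDensity u) (e j)
  let Q := Σ T : {T : Finset (Fin m) // T.card = k}, (T.1 → J)
  -- `β t` extends the labelling `t.2` of the samples in `t.1` by the label `o` of `1` elsewhere.
  let β : Q → Fin m → I := fun t i => if h : i ∈ t.1.1 then (t.2 ⟨i, h⟩ : I) else o
  have hβmem : ∀ (t : Q) i, i ∈ t.1.1 ↔ β t i ≠ o := fun t i => by
    by_cases h : i ∈ t.1.1
    · simpa [β, h] using (t.2 ⟨i, h⟩).2
    · simp [β, h]
  have hβ : Function.Injective β := by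
    rintro ⟨⟨T, hT⟩, α⟩ ⟨⟨T', hT'⟩, α'⟩ h
    obtain rfl : T = T' := by
      ext i
      rw [hβmem ⟨⟨T, hT⟩, α⟩ i, hβmem ⟨⟨T', hT'⟩, α'⟩ i, h]
    congr 1
    ext i
    have := congrFun h i
    simp only [β, i.2, dif_pos] at this
    rw [this]
  let E : Q → Lp ℝ 2 (samples P.null m) := fun t => tensorProduct fun i => e (β t i)
  have hE : Orthonormal ℝ E := (orthonormal_tensorProduct he).comp β hβ
  have hEmem : ∀ t, E t ∈ lowSamplewiseDegree (samples P.null m) d k := fun t =>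
    tensorProduct_mem_lowSamplewiseDegree t.1.1 t.1.2.le (fun i => (b _).2) fun i hi => by
      have : β t i = o := by simp [β, hi]
      simp only [e, this, ho]
  have hprod : ∀ (u : S) (t : Q),
      inner ℝ (lowSamplewisePart d k (tensorPower m (P.relDensity u))) (E t) =
        ∏ i, a u (t.2 i) := fun u t => by
    rw [lowSamplewisePart, Submodule.inner_starProjection_left_eq_right,
      Submodule.starProjection_eq_self_iff.2 (hEmem t), tensorPower_eq_tensorProduct,
      inner_tensorProduct, ← Finset.prod_subset (Finset.subset_univ t.1.1),
      ← Finset.prod_coe_sort]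
    · refine Finset.prod_congr rfl fun i _ => ?_
      simp [β, a]
    · intro i _ hi
      have : β t i = o := by simp [β, hi]
      simp only [e, this, ho, inner_relDensity_const_one]
  have hint : ∀ (t : Q), Integrable (fun u => ∏ i, a u (t.2 i)) P.prior := fun t => by
    simpa only [hprod] using (hG (E t)).1
  have hmean : ∀ t : Q, inner ℝ (E t) (G - Lp.const 2 (samples P.null m) 1) =
      ∫ u, ∏ i, a u (t.2 i) ∂P.prior := fun t => by
    have h1 : inner ℝ (Lp.const 2 (samples P.null m) (1 : ℝ)) (E t) = 0 := by
      obtain ⟨i, hi⟩ := Finset.card_pos.1 (hk0.trans_eq t.1.2.symm)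
      rw [← tensorProduct_const_one, inner_tensorProduct]
      refine Finset.prod_eq_zero (Finset.mem_univ i) ?_
      rw [← ho]
      exact he.2 ((hβmem t i).1 hi).symm
    rw [real_inner_comm, inner_sub_left, h1, sub_zero, ← (hG (E t)).2]
    simp_rw [hprod]
  have hL : ∀ w : S × S, inner ℝ (lowPart d (P.relDensity w.1)) (lowPart d (P.relDensity w.2)) - 1 =
      ∑ j, a w.1 j * a w.2 j := fun w => P.inner_lowPart_relDensity_sub_one b o ho w.1 w.2
  simp_rw [hL]
  have hmoment : ∀ T : {T : Finset (Fin m) // T.card = k},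
      Integrable (fun w : S × S => (∑ j, a w.1 j * a w.2 j) ^ k) (P.prior.prod P.prior) ∧
      ∫ w, (∑ j, a w.1 j * a w.2 j) ^ k ∂P.prior.prod P.prior =
        ∑ α : T.1 → J, (∫ u, ∏ i, a u (α i) ∂P.prior) ^ 2 := fun T => by
    have := integral_sum_mul_pow_card P.prior a (ι := T.1) fun α => hint ⟨T, α⟩
    rwa [Fintype.card_coe, T.2] at this
  obtain ⟨T₀, -, hT₀⟩ := Finset.exists_subset_card_eq
    (s := (Finset.univ : Finset (Fin m))) (n := k) (by simpa using hkm)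
  refine ⟨(hmoment ⟨T₀, hT₀⟩).1, ?_⟩
  have hcard : Fintype.card {T : Finset (Fin m) // T.card = k} = m.choose k := by
    simp
  calc (m.choose k : ℝ) * ∫ w, (∑ j, a w.1 j * a w.2 j) ^ k ∂P.prior.prod P.prior
      = ∑ T : {T : Finset (Fin m) // T.card = k}, ∑ α : T.1 → J,
          (∫ u, ∏ i, a u (α i) ∂P.prior) ^ 2 := by
        rw [Finset.sum_congr rfl fun T _ => (hmoment T).2.symm, Finset.sum_const,
          Finset.card_univ, hcard, nsmul_eq_mul]
    _ = ∑ t : Q, ‖inner ℝ (E t) (G - Lp.const 2 (samples P.null m) 1)‖ ^ 2 := by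
        rw [Fintype.sum_sigma]
        simp_rw [hmean, Real.norm_eq_abs, sq_abs]
    _ ≤ _ := hE.sum_inner_products_le _

/-- The moment of even order `k` of the high-degree correlation is the squared norm of the
high-degree part of the likelihood ratio on `k` samples. -/
theorem lintegral_highPart_pow {d k : ℕ} (hk : Even k) {F : Lp ℝ 2 (samples P.null k)}
    (hF : IsMean P.prior (fun u => tensorPower k (highPart d (P.relDensity u))) F) :
    ∫⁻ w, ENNReal.ofReal (inner ℝ (highPart d (P.relDensity w.1))
      (highPart d (P.relDensity w.2)) ^ k) ∂P.prior.prod P.prior = ENNReal.ofReal (‖F‖ ^ 2) := by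
  have hmeas : Measurable fun w : S × S =>
      inner ℝ (highPart d (P.relDensity w.1)) (highPart d (P.relDensity w.2)) := by
    simp_rw [inner_highPart]
    exact P.measurable_inner_relDensity.sub (P.measurable_inner_lowPart_relDensity d)
  let f : S → Lp ℝ 2 (samples P.null k) := fun u => tensorPower k (highPart d (P.relDensity u))
  have hf : ∀ u v, inner ℝ (f v) (f u) =
      inner ℝ (highPart d (P.relDensity u)) (highPart d (P.relDensity v)) ^ k := fun u v => by
    rw [real_inner_comm]; exact inner_tensorPower _ _
  have h0 : ∀ u v, 0 ≤ inner ℝ (f v) (f u) := fun u v => by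
    rw [hf]; exact hk.pow_nonneg _
  rw [lintegral_prod _ (hmeas.pow_const k).ennreal_ofReal.aemeasurable]
  simp_rw [← hf]
  have h1 : ∀ u, ∫⁻ v, ENNReal.ofReal (inner ℝ (f v) (f u)) ∂P.prior =
      ENNReal.ofReal (inner ℝ (f u) F) := fun u => by
    rw [← ofReal_integral_eq_lintegral_ofReal (hF (f u)).1
      (Filter.Eventually.of_forall fun v => h0 u v), (hF (f u)).2, real_inner_comm]
  have h2 : ∀ u, 0 ≤ inner ℝ (f u) F := fun u => by
    rw [real_inner_comm, ← (hF (f u)).2]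
    exact integral_nonneg fun v => h0 u v
  simp_rw [h1]
  rw [← ofReal_integral_eq_lintegral_ofReal (hF F).1 (Filter.Eventually.of_forall h2), (hF F).2,
    real_inner_self_eq_norm_sq]

end TestingProblem

/-! ### Conditioning on an event that is not too rare -/

/-- Jensen's inequality under conditioning: `E[f | A] ≤ (E[f^k] / Pr(A))^{1/k}`. -/
theorem lintegral_cond_le {Ω : Type*} [MeasurableSpace Ω] (π : Measure Ω) [IsProbabilityMeasure π]
    {f : Ω → ℝ≥0∞} (hf : Measurable f) {k q : ℕ} (hk : 0 < k) {A : Set Ω}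
    (hA : 1 / (q : ℝ≥0∞) ^ 2 ≤ π A) :
    ∫⁻ w, f w ∂cond π A ≤ ((q : ℝ≥0∞) ^ 2 * ∫⁻ w, f w ^ k ∂π) ^ (1 / (k : ℝ)) := by
  have hA0 : π A ≠ 0 := fun h => by
    rw [h, one_div, nonpos_iff_eq_zero, ENNReal.inv_eq_zero] at hA
    exact ENNReal.pow_ne_top (ENNReal.natCast_ne_top q) hA
  have := cond_isProbabilityMeasure hA0
  have hk1 : (1 : ℝ≥0∞) ≤ (k : ℝ≥0∞) := by exact_mod_cast hk
  have hk0 : (k : ℝ≥0∞) ≠ 0 := by exact_mod_cast hk.ne'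
  have h := eLpNorm_le_eLpNorm_of_exponent_le hk1 (μ := cond π A)
    (f := f) hf.aestronglyMeasurable
  rw [eLpNorm_one_eq_lintegral_enorm,
    eLpNorm_eq_lintegral_rpow_enorm_toReal hk0 (ENNReal.natCast_ne_top k)] at h
  simp only [enorm_eq_self, ENNReal.toReal_natCast, ENNReal.rpow_natCast] at h
  refine h.trans (ENNReal.rpow_le_rpow ?_ (by positivity))
  rw [ProbabilityTheory.cond, lintegral_smul_measure, smul_eq_mul]
  gcongr
  · rw [ENNReal.inv_le_iff_inv_le]
    simpa using hA
  · exact Measure.restrict_le_self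

theorem rpow_mul_ofReal_pow_mul_sq {c x : ℝ} (hc : 0 ≤ c) (hx : 0 ≤ x) {k : ℕ} (hk : 0 < k)
    (q : ℕ) :
    ((q : ℝ≥0∞) ^ 2 * ENNReal.ofReal (c ^ k * x ^ 2)) ^ (1 / (k : ℝ)) =
      ENNReal.ofReal ((q : ℝ) ^ (2 / (k : ℝ)) * (c * x ^ (2 / (k : ℝ)))) := by
  have hk' : (k : ℝ) ≠ 0 := by exact_mod_cast hk.ne'
  have hsq : ∀ y : ℝ, 0 ≤ y → (y ^ 2) ^ (1 / (k : ℝ)) = y ^ (2 / (k : ℝ)) := fun y hy => by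
    rw [← Real.rpow_natCast, ← Real.rpow_mul hy]
    congr 1
    push_cast
    ring
  have hq : (0 : ℝ) ≤ q := Nat.cast_nonneg q
  rw [← ENNReal.ofReal_natCast, ← ENNReal.ofReal_pow hq, ← ENNReal.ofReal_mul (by positivity),
    ENNReal.ofReal_rpow_of_nonneg (by positivity) (by positivity),
    Real.mul_rpow (by positivity) (by positivity), Real.mul_rpow (by positivity) (by positivity),
    hsq _ hq, hsq _ hx, one_div, Real.pow_rpow_inv_natCast hc hk.ne']

theorem div_pow_le_choose {k m : ℕ} (hkm : k ≤ m) : ((m : ℝ) / k) ^ k ≤ m.choose k := by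
  induction k generalizing m with
  | zero => simp
  | succ k ih =>
    obtain ⟨m, rfl⟩ : ∃ l, m = l + 1 := ⟨m - 1, by omega⟩
    have hkm' : k ≤ m := by omega
    have hstep : ((m + 1 : ℕ) / (k + 1 : ℕ) : ℝ) ^ k ≤ ((m : ℝ) / k) ^ k := by
      rcases Nat.eq_zero_or_pos k with rfl | hk
      · simp
      · have hk' : (0 : ℝ) < k := by exact_mod_cast hk
        have : (k : ℝ) ≤ m := by exact_mod_cast hkm'
        refine pow_le_pow_left₀ (by positivity) ?_ k
        rw [div_le_div_iff₀ (by positivity) hk']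
        push_cast
        nlinarith
    have hchoose : ((m + 1).choose (k + 1) : ℝ) =
        (m.choose k : ℝ) * ((m + 1 : ℕ) / (k + 1 : ℕ)) := by
      have := Nat.add_one_mul_choose_eq m k
      have h' : ((m + 1 : ℕ) : ℝ) * m.choose k = (m + 1).choose (k + 1) * (k + 1 : ℕ) := by
        exact_mod_cast this
      rw [mul_div_assoc', eq_div_iff (by positivity), ← h', mul_comm]
    rw [pow_succ, hchoose]
    gcongr
    exact hstep.trans (ih hkm')

end

/-! ### From moment bounds to statistical dimension -/

theorem theorem3p1 {n : ℕ} {S : Type*} [MeasurableSpace S] (P : TestingProblem n S)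
    (d k m : ℕ) (hk : Even k) (hk0 : 0 < k) (hkm : k ≤ m) (δ ε : ℝ)
    (F : Lp ℝ 2 (samples P.null k))
    (hF : IsMean P.prior (fun u => tensorPower k (highPart d (P.relDensity u))) F)
    (hδ : ‖F‖ ≤ δ)
    (G : Lp ℝ 2 (samples P.null m))
    (hG : IsMean P.prior (fun u => lowSamplewisePart d k (tensorPower m (P.relDensity u))) G)
    (hε : ‖G - Lp.const 2 (samples P.null m) 1‖ ≤ ε)
    (q : ℕ) (hq : 1 ≤ q) :
    (q : ℕ∞) ≤ P.SDA ((m : ℝ≥0∞) / ENNReal.ofReal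
      ((q : ℝ) ^ (2 / (k : ℝ)) *
        ((k : ℝ) * ε ^ (2 / (k : ℝ)) + δ ^ (2 / (k : ℝ)) * (m : ℝ)))) := by
  have hε0 : 0 ≤ ε := (norm_nonneg _).trans hε
  have hδ0 : 0 ≤ δ := (norm_nonneg _).trans hδ
  have hk' : (0 : ℝ) < k := by exact_mod_cast hk0
  have hm0 : 0 < m := hk0.trans_le hkm
  have hm' : (0 : ℝ) < m := by exact_mod_cast hm0
  suffices h : P.SDABound ((m : ℝ≥0∞) / ENNReal.ofReal
      ((q : ℝ) ^ (2 / (k : ℝ)) *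
        ((k : ℝ) * ε ^ (2 / (k : ℝ)) + δ ^ (2 / (k : ℝ)) * (m : ℝ)))) q from
    le_iSup (fun q : {q : ℕ // P.SDABound _ q} => ((q : ℕ) : ℕ∞)) ⟨q, h⟩
  intro A _ hA
  set L : S × S → ℝ := fun w =>
    inner ℝ (lowPart d (P.relDensity w.1)) (lowPart d (P.relDensity w.2)) - 1 with hL
  set H : S × S → ℝ := fun w =>
    inner ℝ (highPart d (P.relDensity w.1)) (highPart d (P.relDensity w.2)) with hH
  have hLm : Measurable L := (P.measurable_inner_lowPart_relDensity d).sub_const 1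
  have hHm : Measurable H := by
    simp_rw [hH, inner_highPart]
    exact P.measurable_inner_relDensity.sub (P.measurable_inner_lowPart_relDensity d)
  have hsum : ∀ w, inner ℝ (P.relDensity w.1) (P.relDensity w.2) - 1 = L w + H w := fun w => by
    simp only [hL, hH, inner_highPart]
    ring
  have habs : ∀ x : ℝ, ENNReal.ofReal |x| ^ k = ENNReal.ofReal (x ^ k) := fun x => by
    rw [← ENNReal.ofReal_pow (abs_nonneg x), hk.pow_abs]
  have hLk : ∫⁻ w, ENNReal.ofReal |L w| ^ k ∂P.prior.prod P.prior ≤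
      ENNReal.ofReal (((k : ℝ) / m) ^ k * ε ^ 2) := by
    obtain ⟨hi, hle⟩ := P.choose_mul_integral_lowPart_pow_le hk0 hkm hG
    simp_rw [habs]
    rw [← ofReal_integral_eq_lintegral_ofReal hi
      (Filter.Eventually.of_forall fun w => hk.pow_nonneg _)]
    refine ENNReal.ofReal_le_ofReal ?_
    rw [← inv_div (m : ℝ) k, inv_pow, inv_mul_eq_div, le_div_iff₀' (by positivity)]
    calc ((m : ℝ) / k) ^ k * ∫ w, L w ^ k ∂P.prior.prod P.prior
        ≤ (m.choose k : ℝ) * ∫ w, L w ^ k ∂P.prior.prod P.prior :=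
          mul_le_mul_of_nonneg_right (div_pow_le_choose hkm)
            (integral_nonneg fun w => hk.pow_nonneg _)
      _ ≤ _ := hle
      _ ≤ ε ^ 2 := by gcongr
  have hHk : ∫⁻ w, ENNReal.ofReal |H w| ^ k ∂P.prior.prod P.prior ≤
      ENNReal.ofReal (1 ^ k * δ ^ 2) := by
    simp_rw [habs]
    rw [P.lintegral_highPart_pow hk hF, one_pow, one_mul]
    gcongr
  have hbound : ∀ {f : S × S → ℝ} {c x : ℝ}, Measurable f → 0 ≤ c → 0 ≤ x →
      ∫⁻ w, ENNReal.ofReal |f w| ^ k ∂P.prior.prod P.prior ≤ ENNReal.ofReal (c ^ k * x ^ 2) →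
      ∫⁻ w, ENNReal.ofReal |f w| ∂cond (P.prior.prod P.prior) A ≤
        ENNReal.ofReal ((q : ℝ) ^ (2 / (k : ℝ)) * (c * x ^ (2 / (k : ℝ)))) := by
    intro f c x hf hc hx h
    rw [← rpow_mul_ofReal_pow_mul_sq hc hx hk0]
    refine (lintegral_cond_le _ (by fun_prop) hk0 hA).trans ?_
    gcongr
  calc ∫⁻ w, ENNReal.ofReal |inner ℝ (P.relDensity w.1) (P.relDensity w.2) - 1|
        ∂cond (P.prior.prod P.prior) A
      ≤ ∫⁻ w, ENNReal.ofReal |L w| + ENNReal.ofReal |H w| ∂cond (P.prior.prod P.prior) A := by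
        refine lintegral_mono fun w => ?_
        rw [hsum, ← ENNReal.ofReal_add (abs_nonneg _) (abs_nonneg _)]
        exact ENNReal.ofReal_le_ofReal (abs_add_le _ _)
    _ = ∫⁻ w, ENNReal.ofReal |L w| ∂cond (P.prior.prod P.prior) A +
        ∫⁻ w, ENNReal.ofReal |H w| ∂cond (P.prior.prod P.prior) A :=
        lintegral_add_left (by fun_prop) _
    _ ≤ ENNReal.ofReal ((q : ℝ) ^ (2 / (k : ℝ)) * ((k : ℝ) / m * ε ^ (2 / (k : ℝ)))) +
        ENNReal.ofReal ((q : ℝ) ^ (2 / (k : ℝ)) * (1 * δ ^ (2 / (k : ℝ)))) :=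
        add_le_add (hbound hLm (by positivity) hε0 hLk) (hbound hHm zero_le_one hδ0 hHk)
    _ = ENNReal.ofReal ((q : ℝ) ^ (2 / (k : ℝ)) *
          ((k : ℝ) * ε ^ (2 / (k : ℝ)) + δ ^ (2 / (k : ℝ)) * (m : ℝ))) / (m : ℝ≥0∞) := by
        rw [← ENNReal.ofReal_add (by positivity) (by positivity), ← ENNReal.ofReal_natCast m,
          ← ENNReal.ofReal_div_of_pos hm']
        congr 1
        field_simp
    -- As `m ≠ 0`, this holds also for a zero denominator, where the sample parameter is `∞`.
    _ = _ := by
        rw [one_div, ENNReal.inv_div (Or.inl ENNReal.ofReal_ne_top)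
          (Or.inr (by exact_mod_cast hm0.ne'))]
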